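/- For $u\in L^1(0,1)$ let $|Du|((0,1))=\sup\{\int_0^1 u\varphi'\,dx:\varphi\in C^1_c(0,1),\ |\varphi|\le 1\}\in[0,\infty]$, and let $BV(0,1)$ be the set of $u\in L^1(0,1)$ with $|Du|((0,1))<\infty$. A function in $BV(0,1)$ is identified with its precise representative $u(x)=\lim_{r\to0^+}\frac1{2r}\int_{x-r}^{x+r}u\,dy$, and $J_u\subset(0,1)$ denotes its jump set, i.e. the set of points at which the left and right approximate limits of $u$ are different. Let $\lambda\ge 0$ and let $f\in BV(0,1)$ satisfy $0\le f\le 1$ a.e. For $\varepsilon>0$ define $F_\varepsilon:(L^2(0,1))^3\to[0,+\infty]$ by $$F_\varepsilon(u,v_1,v_2)=|Du|((0,1))+\frac1\varepsilon\big(|Dv_1|((0,1))+|Dv_2|((0,1))\big)+\lambda\int_0^1\big(u(v_1-f)^2+(1-u)(v_2-f)^2\big)\,dx$$ if $0\le u\le 1$ a.e., and $F_\varepsilon(u,v_1,v_2)=+\infty$ otherwise. Theorem 2. Assume that $f$ satisfies $$(H)\qquad \mathcal L^1\big(\partial\{x\in(0,1)\setminus J_f: f(x)=c\}\big)=0\quad\text{for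 every } c\in(0,1).$$ Let $0<\varepsilon<\frac1{4\lambda}$ (no upper bound if $\lambda=0$), and let $(u,v_1,v_2)\in(L^2(0,1))^3$ be a minimizer of $F_\varepsilon$. Then $(u,v_1,v_2)$ does not depend on $\varepsilon$, in the sense that it is a minimizer of $F_{\varepsilon'}$ for every $0<\varepsilon'<\frac1{4\lambda}$. Moreover $u\in BV(0,1)$, and either $u$ is (a.e. equal to a) constant or $u\in\{0,1\}$ a.e. in $(0,1)$. -/

import Mathlib

open MeasureTheory Set Filter Topology
open scoped ENNReal

noncomputable section

namespace Segmentation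

/-- Lebesgue measure on the interval `(0,1)`. -/
abbrev μ01 : Measure ℝ := volume.restrict (Ioo (0 : ℝ) 1)

/-- The space `L²(0,1)`. -/
abbrev L2 : Type := Lp ℝ 2 μ01

/-- The total variation `|Du|((0,1))` of `u ∈ L¹(0,1)`: the supremum of `∫ u φ'` over
`φ ∈ C¹_c(0,1)` with `|φ| ≤ 1`. -/
def totalVar (u : ℝ → ℝ) : ℝ≥0∞ :=
  ⨆ (φ : ℝ → ℝ) (_ : ContDiff ℝ 1 φ ∧ HasCompactSupport φ ∧ tsupport φ ⊆ Ioo (0 : ℝ) 1 ∧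
      ∀ x, |φ x| ≤ 1), ENNReal.ofReal (∫ x, u x * deriv φ x ∂μ01)

/-- `u ∈ BV(0,1)`. -/
def MemBV (u : ℝ → ℝ) : Prop :=
  Integrable u μ01 ∧ totalVar u < ∞

/-- `a` is the right approximate limit `u⁺(x)`. -/
def HasRightApproxLimit (u : ℝ → ℝ) (x a : ℝ) : Prop :=
  Tendsto (fun r : ℝ => ⨍ y in Ioo x (x + r), |u y - a|) (𝓝[>] 0) (𝓝 0)

/-- `a` is the left approximate limit `u⁻(x)`. -/
def HasLeftApproxLimit (u : ℝ → ℝ) (x a : ℝ) : Prop :=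
  Tendsto (fun r : ℝ => ⨍ y in Ioo (x - r) x, |u y - a|) (𝓝[>] 0) (𝓝 0)

/-- The jump set `J_u`: points of `(0,1)` with two different one-sided approximate limits. -/
def jumpSet (u : ℝ → ℝ) : Set ℝ :=
  {x | x ∈ Ioo (0 : ℝ) 1 ∧
    ∃ a b : ℝ, a ≠ b ∧ HasLeftApproxLimit u x a ∧ HasRightApproxLimit u x b}

/-- The precise representative, `u*(x) = lim_{r → 0} ⨍_{(x-r,x+r)} u`. For `u ∈ BV(0,1)` the
limit exists at every `x ∈ (0,1)`. -/
def preciseRep (u : ℝ → ℝ) (x : ℝ) : ℝ :=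
  limUnder (𝓝[>] (0 : ℝ)) (fun r : ℝ => ⨍ y in Ioo (x - r) (x + r), u y)

/-- Hypothesis (H): for each `c ∈ (0,1)` the boundary of `{x ∈ (0,1) \ J_f : f(x) = c}` is
Lebesgue null, where `f` is identified with its precise representative. -/
def HypothesisH (f : ℝ → ℝ) : Prop :=
  ∀ c ∈ Ioo (0 : ℝ) 1,
    volume (frontier {x | x ∈ Ioo (0 : ℝ) 1 \ jumpSet f ∧ preciseRep f x = c}) = 0

open Classical in
/-- The indicator `𝕀_{[0,1]}` of convex analysis: `0` on `[0,1]` and `+∞` elsewhere. -/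
def convexInd (t : ℝ) : ℝ≥0∞ := if t ∈ Icc (0 : ℝ) 1 then 0 else ∞

/-- The functional `F_ε` on `L²(0,1)³` with values in `[0,∞]`. The real integrand of the fidelity
term is nonnegative wherever `u ∈ [0,1]`; if `u ∉ [0,1]` on a set of positive measure, the last
term is `∞`. -/
def energy (lam : ℝ) (f : ℝ → ℝ) (ε : ℝ) (u v₁ v₂ : L2) : ℝ≥0∞ :=
  totalVar u + ENNReal.ofReal (1 / ε) * (totalVar v₁ + totalVar v₂)
    + ENNReal.ofReal lam *
        ∫⁻ x, ENNReal.ofReal (u x * (v₁ x - f x) ^ 2 + (1 - u x) * (v₂ x - f x) ^ 2) ∂μ01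
    + ∫⁻ x, convexInd (u x) ∂μ01

/-- `(u, v₁, v₂)` is a global minimizer of `F_ε` on `L²(0,1)³`. -/
def IsMinimizer (lam : ℝ) (f : ℝ → ℝ) (ε : ℝ) (u v₁ v₂ : L2) : Prop :=
  ∀ w w₁ w₂ : L2, energy lam f ε u v₁ v₂ ≤ energy lam f ε w w₁ w₂

end Segmentation

end

noncomputable section

namespace Segmentation

/-! The argument first shows that `v₁` and `v₂` are constant, then exploits that for constant `v₁ =
c₁`, `v₂ = c₂` the fidelity is affine in `u`.

Constancy. Let `c` be the mean of `f` with weight `w`. By convexity of the square, the error of `v`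
exceeds that of `c` by at least `-2 ∫ v w (f - c)`. The factor `w (f - c)` has mean zero and a
primitive bounded by 1, so duality bounds this integral by the total variation of `v`
(`integral_mul_le_mul_totalVar`). Passing to constants thus costs at most `2 lam` per unit of
variation and saves `1 / ε`, which is more. Minimizers therefore have constant `v₁`, `v₂`, and `ε`
drops out of the problem.

Two values. Write `2u = a + b` with `a = min (2u) 1` and `b = max (2u - 1) 0`. Variations add along
this splitting (`totalVar_add_totalVar_le`) and the fidelity is affine, so `a` and `b` are again
optimal with the same `c₁`, `c₂`. Optimality of the constants makes `f - c₁` and `f - c₂` both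
orthogonal to `a - b`; subtracting, `(c₂ - c₁) ∫ (a - b) = 0`. If `c₁ ≠ c₂`, then `a = b`, as `a ≥
b`, which means `u` is 0 or 1. If `c₁ = c₂` or `lam = 0`, the fidelity ignores `u`, and comparison
with `u = 0` forces zero variation. -/

/-! ### Integrals on the unit interval and elementary facts on total variation -/

theorem totalVar_congr {u v : ℝ → ℝ} (h : u =ᵐ[μ01] v) : totalVar u = totalVar v := by
  unfold totalVar
  refine iSup_congr fun φ => iSup_congr fun _ => ?_
  congr 1
  exact integral_congr_ae (h.mono fun x hx => by simp only [hx])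

instance : IsProbabilityMeasure μ01 := ⟨by simp⟩

theorem integral_unit_eq (g : ℝ → ℝ) : ∫ x, g x ∂μ01 = ∫ x in (0 : ℝ)..1, g x := by
  rw [intervalIntegral.integral_of_le zero_le_one, integral_Ioc_eq_integral_Ioo]

theorem intervalIntegrable_of_integrable {g : ℝ → ℝ} (hg : Integrable g μ01) {x : ℝ}
    (hx : x ∈ Icc (0 : ℝ) 1) : IntervalIntegrable g volume 0 x := by
  rw [intervalIntegrable_iff_integrableOn_Ioo_of_le hx.1]
  exact IntegrableOn.mono_set hg (Ioo_subset_Ioo_right hx.2)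

theorem abs_primitive_le {g : ℝ → ℝ} (hg : Integrable g μ01) {x : ℝ}
    (hx : x ∈ Icc (0 : ℝ) 1) : |∫ y in (0 : ℝ)..x, g y| ≤ ∫ y, |g y| ∂μ01 := by
  rw [intervalIntegral.integral_of_le hx.1, integral_Ioc_eq_integral_Ioo]
  refine (abs_integral_le_integral_abs).trans ?_
  exact setIntegral_mono_set hg.abs (ae_of_all _ fun _ => abs_nonneg _)
    (Ioo_subset_Ioo_right hx.2).eventuallyLE

theorem ofReal_integral_le_totalVar (u : ℝ → ℝ) {φ : ℝ → ℝ} (h1 : ContDiff ℝ 1 φ)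
    (h2 : HasCompactSupport φ) (h3 : tsupport φ ⊆ Ioo (0 : ℝ) 1) (h4 : ∀ x, |φ x| ≤ 1) :
    ENNReal.ofReal (∫ x, u x * deriv φ x ∂μ01) ≤ totalVar u :=
  le_iSup₂_of_le (f := fun φ _ => ENNReal.ofReal (∫ x, u x * deriv φ x ∂μ01)) φ
    ⟨h1, h2, h3, h4⟩ le_rfl

theorem integral_deriv_eq_zero_of_tsupport {φ : ℝ → ℝ} (h1 : ContDiff ℝ 1 φ)
    (h3 : tsupport φ ⊆ Ioo (0 : ℝ) 1) : ∫ x, deriv φ x ∂μ01 = 0 := by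
  have z0 : φ 0 = 0 := image_eq_zero_of_notMem_tsupport fun h => by simpa using h3 h
  have z1 : φ 1 = 0 := image_eq_zero_of_notMem_tsupport fun h => by simpa using h3 h
  rw [integral_unit_eq, intervalIntegral.integral_deriv_eq_sub
    (fun x _ => (h1.differentiable one_ne_zero) x)
    ((h1.continuous_deriv le_rfl).intervalIntegrable _ _), z0, z1, sub_zero]

theorem totalVar_const (c : ℝ) : totalVar (fun _ => c) = 0 := by
  unfold totalVar
  simp only [ENNReal.iSup_eq_zero]
  rintro φ ⟨h1, -, h3, -⟩
  rw [integral_const_mul, integral_deriv_eq_zero_of_tsupport h1 h3]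
  simp

/-! ### Duality between total variation and mean-zero functions with bounded primitive -/

/-- `T` bounds the pairing of `v` with `w` relative to sup bounds of the primitive of `w`. -/
def PairingBound (v : ℝ → ℝ) (T : ℝ) (w : ℝ → ℝ) : Prop :=
  ∀ K : ℝ, 0 < K → (∀ x ∈ Icc (0 : ℝ) 1, |∫ y in (0 : ℝ)..x, w y| ≤ K) →
    ∫ x, v x * w x ∂μ01 ≤ K * T

/-- The primitive of `g` divided by `K` is itself an admissible test function: zero mean makes it
vanish to the right of the support as well as to the left. -/
theorem pairingBound_of_tsupport {v g : ℝ → ℝ} (hv : totalVar v ≠ ∞)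
    (hg : Continuous g) {α β : ℝ} (hα : 0 < α) (hβ : β < 1)
    (hsupp : ∀ x, x ∉ Icc α β → g x = 0) (h0 : ∫ x, g x ∂μ01 = 0) :
    PairingBound v (totalVar v).toReal g := by
  intro K hK hb
  set W : ℝ → ℝ := fun x => ∫ y in (0 : ℝ)..x, g y with hW
  have hd : ∀ x, HasDerivAt W (g x) x := fun x =>
    intervalIntegral.integral_hasDerivAt_right (hg.intervalIntegrable _ _)
      (hg.stronglyMeasurableAtFilter _ _) hg.continuousAt
  have hzero : ∀ x, x ∉ Icc α β → W x = 0 := by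
    intro x hx
    by_cases hxα : x < α
    · refine intervalIntegral.integral_zero_ae (ae_of_all _ fun y hy => hsupp y fun h => ?_)
      rcases le_total 0 x with h' | h'
      · rw [uIoc_of_le h'] at hy; linarith [hy.2, h.1]
      · rw [uIoc_of_ge h'] at hy; linarith [hy.2, h.1]
    · have hxβ : β < x := by
        by_contra h; exact hx ⟨not_lt.1 hxα, not_lt.1 h⟩
      have h1 : W 1 = 0 := by rw [hW]; simp only; rw [← integral_unit_eq, h0]
      have h2 : W 1 + ∫ y in (1 : ℝ)..x, g y = W x :=
        intervalIntegral.integral_add_adjacent_intervals (hg.intervalIntegrable _ _)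
          (hg.intervalIntegrable _ _)
      rw [← h2, h1, zero_add]
      refine intervalIntegral.integral_zero_ae (ae_of_all _ fun y hy => hsupp y fun h => ?_)
      rcases le_total 1 x with h' | h'
      · rw [uIoc_of_le h'] at hy; linarith [hy.1, h.2]
      · rw [uIoc_of_ge h'] at hy; linarith [hy.1, h.2]
  have hsub : tsupport (fun x => K⁻¹ * W x) ⊆ Icc α β := by
    refine closure_minimal (fun x hx => ?_) isClosed_Icc
    by_contra h
    exact hx (by simp [hzero x h])
  have hderiv : deriv (fun x => K⁻¹ * W x) = fun x => K⁻¹ * g x :=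
    funext fun x => ((hd x).const_mul _).deriv
  have hC : ContDiff ℝ 1 (fun x => K⁻¹ * W x) := by
    rw [contDiff_one_iff_deriv, hderiv]
    exact ⟨fun x => ((hd x).const_mul _).differentiableAt, by fun_prop⟩
  have hle : ∀ x, |K⁻¹ * W x| ≤ 1 := by
    intro x
    rw [abs_mul, abs_inv, abs_of_pos hK, inv_mul_le_iff₀ hK, mul_one]
    by_cases hx : x ∈ Icc α β
    · exact hb x ⟨hα.le.trans hx.1, hx.2.trans hβ.le⟩
    · rw [hzero x hx]; simpa using hK.le
  have key := ofReal_integral_le_totalVar v hC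
    (isCompact_Icc.of_isClosed_subset (isClosed_tsupport _) hsub)
    (hsub.trans fun x hx => ⟨hα.trans_le hx.1, hx.2.trans_lt hβ⟩) hle
  rw [hderiv] at key
  have h2 := (ENNReal.ofReal_le_iff_le_toReal hv).1 key
  have h3 : ∫ x, v x * (K⁻¹ * g x) ∂μ01 = K⁻¹ * ∫ x, v x * g x ∂μ01 := by
    rw [← integral_const_mul]; congr 1; ext x; ring
  rwa [h3, inv_mul_le_iff₀ hK] at h2

/-- Closeness in `L¹` makes primitives uniformly close, so a bound `K` for `w` becomes `K + δ` for
`g`. The total loss is `δ (1 + T)`, whence the choice of `δ`. -/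
theorem PairingBound.of_approx {v w : ℝ → ℝ} {T : ℝ} (hT : 0 ≤ T) (hw : Integrable w μ01)
    (h : ∀ δ : ℝ, 0 < δ → ∃ g, Integrable g μ01 ∧ PairingBound v T g ∧
      ∫ x, |w x - g x| ∂μ01 ≤ δ ∧ ∫ x, v x * w x ∂μ01 ≤ ∫ x, v x * g x ∂μ01 + δ) :
    PairingBound v T w := by
  intro K hK hb
  refine le_of_forall_pos_le_add fun η hη => ?_
  obtain ⟨g, hgi, hg, h1, h2⟩ := h (η / (1 + T)) (by positivity)
  set δ := η / (1 + T)
  have hδ : 0 < δ := by positivity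
  have := hg (K + δ) (by positivity) fun x hx => by
    have e : ∫ y in (0 : ℝ)..x, g y = (∫ y in (0 : ℝ)..x, w y) - ∫ y in (0 : ℝ)..x, (w y - g y) := by
      rw [intervalIntegral.integral_sub (intervalIntegrable_of_integrable hw hx)
        (intervalIntegrable_of_integrable hgi hx)]; ring
    rw [e]
    refine (abs_sub _ _).trans (add_le_add (hb x hx) ?_)
    exact (abs_primitive_le (hw.sub hgi) hx).trans h1
  have e : δ * (1 + T) = η := by simp only [δ]; field_simp
  nlinarith

/-- Continuous cutoff functions increasing to `1` on `(0,1)`. -/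
def cutoff (n : ℕ) (x : ℝ) : ℝ := max 0 (min 1 (n * min x (1 - x) - 1))

theorem continuous_cutoff (n : ℕ) : Continuous (cutoff n) := by unfold cutoff; fun_prop

theorem cutoff_nonneg (n : ℕ) (x : ℝ) : 0 ≤ cutoff n x := le_max_left _ _

theorem cutoff_le_one (n : ℕ) (x : ℝ) : cutoff n x ≤ 1 :=
  max_le zero_le_one (min_le_left _ _)

theorem abs_cutoff_le_one (n : ℕ) (x : ℝ) : |cutoff n x| ≤ 1 :=
  abs_le.2 ⟨by linarith [cutoff_nonneg n x], cutoff_le_one n x⟩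

theorem cutoff_eq_zero {n : ℕ} (hn : 0 < n) {x : ℝ} (hx : x ∉ Icc (1 / (n : ℝ)) (1 - 1 / n)) :
    cutoff n x = 0 := by
  have hn' : (0 : ℝ) < n := by exact_mod_cast hn
  refine max_eq_left ((min_le_right _ _).trans ?_)
  have : min x (1 - x) ≤ 1 / (n : ℝ) := by
    by_contra h
    push Not at h
    rw [lt_min_iff] at h
    exact hx ⟨h.1.le, by linarith [h.2]⟩
  have := mul_le_mul_of_nonneg_left this hn'.le
  rw [mul_one_div_cancel hn'.ne'] at this
  linarith

theorem tendsto_cutoff {x : ℝ} (hx : x ∈ Ioo (0 : ℝ) 1) :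
    Tendsto (fun n => cutoff n x) atTop (𝓝 1) := by
  have hm : 0 < min x (1 - x) := lt_min hx.1 (by linarith [hx.2])
  refine tendsto_const_nhds.congr' ?_
  have h := (tendsto_natCast_atTop_atTop (R := ℝ)).atTop_mul_const hm
  filter_upwards [h.eventually_ge_atTop 2] with n hn
  unfold cutoff
  rw [min_eq_left (by linarith), max_eq_right zero_le_one]

theorem tendsto_integral_mul_cutoff {h : ℝ → ℝ} (hh : Integrable h μ01) :
    Tendsto (fun n => ∫ x, h x * cutoff n x ∂μ01) atTop (𝓝 (∫ x, h x ∂μ01)) := by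
  refine tendsto_integral_of_dominated_convergence (fun x => |h x|) (fun n => ?_) hh.abs
    (fun n => ae_of_all _ fun x => ?_) ?_
  · exact hh.aestronglyMeasurable.mul (continuous_cutoff n).aestronglyMeasurable
  · rw [Real.norm_eq_abs, abs_mul]
    exact mul_le_of_le_one_right (abs_nonneg _) (abs_cutoff_le_one n x)
  · filter_upwards [ae_restrict_mem measurableSet_Ioo] with x hx
    simpa using (tendsto_cutoff hx).const_mul (h x)

theorem integrable_of_continuous {g : ℝ → ℝ} (hg : Continuous g) : Integrable g μ01 :=
  (hg.integrableOn_Icc (a := 0) (b := 1)).mono_set Ioo_subset_Icc_self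

theorem pairingBound_of_continuous {v g : ℝ → ℝ} (hvi : Integrable v μ01) (hv : totalVar v ≠ ∞)
    (hg : Continuous g) (h0 : ∫ x, g x ∂μ01 = 0) :
    PairingBound v (totalVar v).toReal g := by
  have hgi := integrable_of_continuous hg
  have hvg : Integrable (fun x => v x * g x) μ01 := by
    obtain ⟨C, hC⟩ := isCompact_Icc.exists_bound_of_continuousOn (hg.continuousOn (s := Icc (0 : ℝ) 1))
    refine hvi.mul_bdd (c := C) hg.aestronglyMeasurable ?_
    filter_upwards [ae_restrict_mem measurableSet_Ioo] with x hx
    exact hC x (Ioo_subset_Icc_self hx)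
  refine PairingBound.of_approx ENNReal.toReal_nonneg hgi fun δ hδ => ?_
  -- Cutting off destroys the zero mean. Subtracting the cutoff-weighted mean `m n` beforehand
  -- restores it, and `m n` tends to 0.
  set m : ℕ → ℝ := fun n => (∫ x, g x * cutoff n x ∂μ01) / ∫ x, 1 * cutoff n x ∂μ01 with hm
  have hone : Tendsto (fun n => ∫ x, 1 * cutoff n x ∂μ01) atTop (𝓝 1) := by
    have := tendsto_integral_mul_cutoff (h := fun _ => (1 : ℝ)) (integrable_of_continuous continuous_const)
    simpa using this
  have hmlim : Tendsto m atTop (𝓝 0) := by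
    have := (tendsto_integral_mul_cutoff hgi).div hone one_ne_zero
    rwa [h0, zero_div] at this
  set G : ℕ → ℝ → ℝ := fun n x => (g x - m n) * cutoff n x with hG
  have hGc : ∀ n, Continuous (G n) := fun n => by
    have := continuous_cutoff n
    simp only [hG]; fun_prop
  have e1 : Tendsto (fun n => ∫ x, v x * G n x ∂μ01) atTop (𝓝 (∫ x, v x * g x ∂μ01)) := by
    have := (tendsto_integral_mul_cutoff hvg).sub (hmlim.mul (tendsto_integral_mul_cutoff hvi))
    rw [zero_mul, sub_zero] at this
    refine this.congr fun n => ?_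
    have i1 : Integrable (fun x => v x * g x * cutoff n x) μ01 :=
      hvg.mul_bdd (c := 1) (continuous_cutoff n).aestronglyMeasurable
        (ae_of_all _ fun x => abs_cutoff_le_one n x)
    have i2 : Integrable (fun x => v x * cutoff n x) μ01 :=
      hvi.mul_bdd (c := 1) (continuous_cutoff n).aestronglyMeasurable
        (ae_of_all _ fun x => abs_cutoff_le_one n x)
    rw [← integral_const_mul, ← integral_sub i1 (i2.const_mul _)]
    congr 1; ext x; simp only [hG]; ring
  have e2 : Tendsto (fun n => ∫ x, |g x - G n x| ∂μ01) atTop (𝓝 0) := by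
    have A := ((tendsto_const_nhds (x := ∫ x, |g x| ∂μ01)).sub
      (tendsto_integral_mul_cutoff hgi.abs)).add hmlim.abs
    rw [sub_self, abs_zero, zero_add] at A
    refine squeeze_zero (fun n => integral_nonneg fun x => abs_nonneg _) (fun n => ?_) A
    have i1 : Integrable (fun x => |g x| * cutoff n x) μ01 :=
      hgi.abs.mul_bdd (c := 1) (continuous_cutoff n).aestronglyMeasurable
        (ae_of_all _ fun x => abs_cutoff_le_one n x)
    have : |m n| = ∫ x, |m n| ∂μ01 := by simp
    have i2 : Integrable (fun x => |g x| - |g x| * cutoff n x) μ01 := hgi.abs.sub i1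
    rw [this, ← integral_sub hgi.abs i1, ← integral_add i2 (integrable_const _)]
    refine integral_mono (hgi.sub (integrable_of_continuous (hGc n))).abs
      (i2.add (integrable_const _)) fun x => ?_
    have e : g x - G n x = g x * (1 - cutoff n x) + m n * cutoff n x := by
      simp only [hG]; ring
    beta_reduce
    rw [e]
    refine (abs_add_le _ _).trans ?_
    rw [abs_mul, abs_mul, abs_of_nonneg (sub_nonneg.2 (cutoff_le_one n x)), abs_of_nonneg (cutoff_nonneg n x)]
    nlinarith [cutoff_le_one n x, abs_nonneg (m n)]
  obtain ⟨n, ⟨⟨hnpos, hn1⟩, hn2⟩, hn4⟩ := (((eventually_gt_atTop 0).and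
    (hone.eventually (lt_mem_nhds (show (0 : ℝ) < 1 by norm_num)))).and
    (e2.eventually (gt_mem_nhds hδ))).and
    (e1.eventually (lt_mem_nhds (show (∫ x, v x * g x ∂μ01) - δ < ∫ x, v x * g x ∂μ01 by linarith))) |>.exists
  refine ⟨G n, integrable_of_continuous (hGc n), ?_, hn2.le, by linarith⟩
  have hn0 : (0 : ℝ) < n := by exact_mod_cast hnpos
  refine pairingBound_of_tsupport hv (hGc n) (α := 1 / n) (β := 1 - 1 / n) (by positivity)
    (by linarith [one_div_pos.2 hn0]) (fun x hx => ?_) ?_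
  · simp only [hG]; rw [cutoff_eq_zero hnpos hx, mul_zero]
  · have hgc : Integrable (fun x => g x * cutoff n x) μ01 :=
      integrable_of_continuous (hg.mul (continuous_cutoff n))
    have hc : Integrable (fun x => 1 * cutoff n x) μ01 :=
      integrable_of_continuous (continuous_const.mul (continuous_cutoff n))
    have : ∀ x, G n x = g x * cutoff n x - m n * (1 * cutoff n x) := fun x => by
      simp only [hG]; ring
    simp_rw [this]
    rw [integral_sub hgc (hc.const_mul _), integral_const_mul, hm]
    simp only
    rw [div_mul_cancel₀ _ hn1.ne', sub_self]

/-- Continuous functions are dense in `L²`, and `v ∈ L²` lets the pairing pass to the limit; the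
approximant is recentred to have mean zero. -/
theorem pairingBound_of_memLp {v w : ℝ → ℝ} (hvL : MemLp v 2 μ01) (hv : totalVar v ≠ ∞)
    (hw : MemLp w 2 μ01) (h0 : ∫ x, w x ∂μ01 = 0) :
    PairingBound v (totalVar v).toReal w := by
  have hvi := hvL.integrable (by norm_num)
  have hwi := hw.integrable (by norm_num)
  refine PairingBound.of_approx ENNReal.toReal_nonneg hwi fun δ hδ => ?_
  set B : ℝ := (eLpNorm v 2 μ01).toReal with hB
  have hB0 : 0 ≤ B := ENNReal.toReal_nonneg
  -- With `δ = C τ`, this absorbs the `L¹` error `2τ` and the pairing error `(B + ∫ |v|) τ`,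
  -- recentring included.
  set C : ℝ := 2 + B + ∫ x, |v x| ∂μ01 with hC
  have hC0 : 0 < C := by
    have : 0 ≤ ∫ x, |v x| ∂μ01 := integral_nonneg fun x => abs_nonneg _
    positivity
  set τ : ℝ := δ / C with hτ
  have hτ0 : 0 < τ := by positivity
  obtain ⟨g, -, hg, hgc, hgL⟩ := hw.exists_hasCompactSupport_eLpNorm_sub_le (by norm_num)
    (ε := ENNReal.ofReal τ) (by simpa using hτ0)
  have hgi := integrable_of_continuous hgc
  set e : ℝ := ∫ x, g x ∂μ01 with he
  have hdL : MemLp (w - g) 2 μ01 := hw.sub hgL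
  have d1 : ∫ x, |w x - g x| ∂μ01 ≤ τ := by
    have h1 : eLpNorm (w - g) 1 μ01 ≤ ENNReal.ofReal τ :=
      (eLpNorm_le_eLpNorm_of_exponent_le (by norm_num) hdL.1).trans hg
    have h2 := integral_norm_eq_lintegral_enorm (μ := μ01) (hwi.sub hgi).1
    rw [← eLpNorm_one_eq_lintegral_enorm] at h2
    have h3 := ENNReal.toReal_le_of_le_ofReal hτ0.le h1
    calc ∫ x, |w x - g x| ∂μ01 = ∫ x, ‖(w - g) x‖ ∂μ01 := rfl
      _ ≤ τ := by rw [h2]; exact h3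
  have de : |e| ≤ τ := by
    have : e = -∫ x, (w x - g x) ∂μ01 := by rw [integral_sub hwi hgi, h0]; ring
    rw [this, abs_neg]
    exact abs_integral_le_integral_abs.trans d1
  have hvw : Integrable (fun x => v x * w x) μ01 := hvL.integrable_mul hw
  have hvg : Integrable (fun x => v x * g x) μ01 := hvL.integrable_mul hgL
  have d2 : ∫ x, v x * (w x - g x) ∂μ01 ≤ B * τ := by
    have hs : eLpNorm (v • (w - g)) 1 μ01 ≤ eLpNorm v 2 μ01 * eLpNorm (w - g) 2 μ01 :=
      eLpNorm_smul_le_mul_eLpNorm hdL.1 hvL.1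
    have hs2 := hs.trans (mul_le_mul_right hg (eLpNorm v 2 μ01))
    have hfin : eLpNorm v 2 μ01 * ENNReal.ofReal τ ≠ ∞ :=
      ENNReal.mul_ne_top hvL.2.ne ENNReal.ofReal_ne_top
    have hs3 := ENNReal.toReal_mono hfin hs2
    rw [ENNReal.toReal_mul, ENNReal.toReal_ofReal hτ0.le] at hs3
    have hi : Integrable (v • (w - g)) μ01 := hvL.integrable_mul hdL
    have h2 := integral_norm_eq_lintegral_enorm (μ := μ01) hi.1
    rw [← eLpNorm_one_eq_lintegral_enorm] at h2
    calc ∫ x, v x * (w x - g x) ∂μ01 ≤ ∫ x, ‖(v • (w - g)) x‖ ∂μ01 :=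
          integral_mono hi hi.norm fun x => le_abs_self _
      _ ≤ B * τ := by rw [h2]; exact hs3
  have hgc' : Continuous fun x => g x - e := by fun_prop
  refine ⟨fun x => g x - e, integrable_of_continuous hgc',
    pairingBound_of_continuous hvi hv hgc' ?_, ?_, ?_⟩
  · rw [integral_sub hgi (integrable_const _)]; simp [he]
  · calc ∫ x, |w x - (g x - e)| ∂μ01 ≤ ∫ x, (|w x - g x| + |e|) ∂μ01 := by
          refine integral_mono (hwi.sub (integrable_of_continuous hgc')).abs
            ((hwi.sub hgi).abs.add (integrable_const _)) fun x => ?_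
          have : w x - (g x - e) = (w x - g x) + e := by ring
          simp only
          rw [this]
          exact abs_add_le _ _
      _ = (∫ x, |w x - g x| ∂μ01) + |e| := by
          have i : Integrable (fun x => |w x - g x|) μ01 := (hwi.sub hgi).abs
          rw [integral_add i (integrable_const _)]; simp
      _ ≤ τ + τ := add_le_add d1 de
      _ ≤ δ := by
          have : C * τ = δ := by simp only [hτ]; field_simp
          have : 0 ≤ ∫ x, |v x| ∂μ01 := integral_nonneg fun x => abs_nonneg _
          nlinarith
  · have a1 : ∫ x, v x * (w x - g x) ∂μ01 = (∫ x, v x * w x ∂μ01) - ∫ x, v x * g x ∂μ01 := by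
      rw [← integral_sub hvw hvg]; congr 1; ext x; ring
    have a2 : ∫ x, v x * (g x - e) ∂μ01 = (∫ x, v x * g x ∂μ01) - e * ∫ x, v x ∂μ01 := by
      rw [← integral_const_mul, ← integral_sub hvg (hvi.const_mul _)]; congr 1; ext x; ring
    have a3 : e * ∫ x, v x ∂μ01 ≤ τ * ∫ x, |v x| ∂μ01 := by
      refine (le_abs_self _).trans ?_
      rw [abs_mul]
      exact mul_le_mul de abs_integral_le_integral_abs (abs_nonneg _) hτ0.le
    have : C * τ = δ := by simp only [hτ]; field_simp
    rw [a2]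
    nlinarith

/-- Integration by parts against primitives: the total variation controls `∫ v w` when `w` has
mean zero and a bounded primitive. -/
theorem integral_mul_le_mul_totalVar {v w : ℝ → ℝ} (hvL : MemLp v 2 μ01) (hv : totalVar v ≠ ∞)
    (hw : MemLp w 2 μ01) (h0 : ∫ x, w x ∂μ01 = 0) {K : ℝ}
    (hK : ∀ x ∈ Icc (0 : ℝ) 1, |∫ y in (0 : ℝ)..x, w y| ≤ K) :
    ∫ x, v x * w x ∂μ01 ≤ K * (totalVar v).toReal := by
  set T := (totalVar v).toReal with hT
  have hT0 : 0 ≤ T := ENNReal.toReal_nonneg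
  have hK0 : 0 ≤ K := by simpa using hK 0 (by simp)
  -- `PairingBound` asks for a positive constant while `K` may be 0, so `K` is enlarged slightly.
  refine le_of_forall_pos_le_add fun η hη => ?_
  have h := pairingBound_of_memLp hvL hv hw h0 (K + η / (1 + T)) (by positivity)
    fun x hx => (hK x hx).trans (by linarith [show 0 < η / (1 + T) by positivity])
  have e : η / (1 + T) * (1 + T) = η := by field_simp
  have : 0 < η / (1 + T) := by positivity
  nlinarith

/-- Testing against `v - c`, with `c` the mean of `v`, gives `∫ (v - c)² = ∫ v (v - c) ≤ 0`. -/
theorem ae_eq_const_of_totalVar_eq_zero {v : ℝ → ℝ} (hvL : MemLp v 2 μ01)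
    (hv : totalVar v = 0) : ∃ c : ℝ, v =ᵐ[μ01] fun _ => c := by
  have hvi := hvL.integrable (by norm_num)
  set c := ∫ x, v x ∂μ01 with hc
  have hcL : MemLp (fun _ : ℝ => c) 2 μ01 := memLp_const c
  have hwL : MemLp (fun x => v x - c) 2 μ01 := hvL.sub hcL
  have hwi := hwL.integrable (by norm_num)
  have h0 : ∫ x, (v x - c) ∂μ01 = 0 := by
    rw [integral_sub hvi (integrable_const _)]; simp [hc]
  have h := integral_mul_le_mul_totalVar hvL (by simp [hv]) hwL h0
    fun x hx => abs_primitive_le hwi hx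
  rw [hv, ENNReal.toReal_zero, mul_zero] at h
  have hsq : Integrable (fun x => (v x - c) ^ 2) μ01 := hwL.integrable_sq
  have e : ∫ x, (v x - c) ^ 2 ∂μ01 = ∫ x, v x * (v x - c) ∂μ01 := by
    have : ∀ x, (v x - c) ^ 2 = v x * (v x - c) - c * (v x - c) := fun x => by ring
    simp_rw [this]
    have i : Integrable (fun x => v x * (v x - c)) μ01 := hvL.integrable_mul hwL
    rw [integral_sub i (hwi.const_mul c), integral_const_mul, h0]
    ring
  have z : ∫ x, (v x - c) ^ 2 ∂μ01 = 0 :=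
    le_antisymm (e.trans_le h) (integral_nonneg fun x => sq_nonneg _)
  refine ⟨c, ?_⟩
  filter_upwards [(integral_eq_zero_iff_of_nonneg (fun x => sq_nonneg _) hsq).1 z] with x hx
  have : (v x - c) ^ 2 = 0 := hx
  nlinarith

/-! ### Translation estimates and additivity of variation under splitting -/

/-- Duality with `w = S(· - h) - S`, where `S` is the sign of the increment of `u`. A change of
variables turns the pairing into the left side, and the primitive of `w` is minus the integral of
`S` over a window of length `h`. -/
theorem setIntegral_abs_sub_shift_le {u : ℝ → ℝ} (hum : Measurable u) (huL : MemLp u 2 μ01)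
    (hu : totalVar u ≠ ∞) {h : ℝ} (h0 : 0 < h) :
    ∫ x in Ioo 0 (1 - h), |u (x + h) - u x| ≤ h * (totalVar u).toReal := by
  have hui : IntegrableOn u (Ioo 0 1) := huL.integrable (by norm_num)
  set S : ℝ → ℝ := (Ioo 0 (1 - h)).indicator fun x => Real.sign (u (x + h) - u x) with hS
  have hsm : Measurable Real.sign :=
    Measurable.ite (measurableSet_lt measurable_id measurable_const) measurable_const
      (Measurable.ite (measurableSet_lt measurable_const measurable_id) measurable_const
        measurable_const)
  have hSm : Measurable S :=
    (hsm.comp ((hum.comp (measurable_id.add_const h)).sub hum)).indicator measurableSet_Ioo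
  have hS1 : ∀ x, |S x| ≤ 1 := by
    intro x
    simp only [hS, indicator]
    split_ifs
    · rcases Real.sign_apply_eq (u (x + h) - u x) with e | e | e <;> rw [e] <;> norm_num
    · norm_num
  have hSz : ∀ x, x ∉ Ioo 0 (1 - h) → S x = 0 := fun x hx => indicator_of_notMem hx _
  have hSi : Integrable S := by
    have : IntegrableOn S (Ioo 0 (1 - h)) :=
      Measure.integrableOn_of_bounded (M := 1) (by simp) hSm.aestronglyMeasurable
        (ae_of_all _ hS1)
    exact (integrableOn_iff_integrable_of_support_subset
      (fun x hx => by by_contra hc; exact hx (hSz x hc))).1 this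
  have hSi' : Integrable fun y => S (y - h) := hSi.comp_sub_right h
  set w : ℝ → ℝ := fun y => S (y - h) - S y with hw
  have hwL : MemLp w 2 μ01 := by
    refine MemLp.of_bound ((hSm.comp (measurable_id.sub_const h)).sub hSm).aestronglyMeasurable 2
      (ae_of_all _ fun x => ?_)
    refine (abs_sub _ _).trans ?_
    linarith [hS1 (x - h), hS1 x]
  have hz1 : ∀ y, y ∉ Ioo (0 : ℝ) 1 → S y = 0 := fun y hy => hSz y fun hc =>
    hy ⟨hc.1, by linarith [hc.2]⟩
  have hz2 : ∀ y, y ∉ Ioo (0 : ℝ) 1 → S (y - h) = 0 := fun y hy => hSz _ fun hc =>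
    hy ⟨by linarith [hc.1], by linarith [hc.2]⟩
  have hw0 : ∫ y, w y ∂μ01 = 0 := by
    rw [setIntegral_eq_integral_of_forall_compl_eq_zero
      (fun y hy => by simp only [hw]; rw [hz1 y hy, hz2 y hy, sub_zero])]
    simp only [hw]
    rw [integral_sub hSi' hSi, integral_sub_right_eq_self S h, sub_self]
  have hprim : ∀ x ∈ Icc (0 : ℝ) 1, |∫ y in (0 : ℝ)..x, w y| ≤ h := by
    intro x _
    have e : ∫ y in (0 : ℝ)..x, w y = -∫ y in (x - h)..x, S y := by
      simp only [hw]
      rw [intervalIntegral.integral_sub hSi'.intervalIntegrable hSi.intervalIntegrable,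
        intervalIntegral.integral_comp_sub_right (fun y => S y) h,
        intervalIntegral.integral_interval_sub_interval_comm hSi.intervalIntegrable
          hSi.intervalIntegrable hSi.intervalIntegrable]
      rw [intervalIntegral.integral_zero_ae, zero_sub]
      refine ae_of_all _ fun y hy => hSz y fun hc => ?_
      rw [uIoc_of_le (by linarith)] at hy
      linarith [hy.2, hc.1]
    rw [e, abs_neg, ← Real.norm_eq_abs]
    refine (intervalIntegral.norm_integral_le_of_norm_le_const (C := 1) fun y _ => hS1 y).trans ?_
    rw [one_mul, sub_sub_cancel, abs_of_pos h0]
  have key := integral_mul_le_mul_totalVar huL hu hwL hw0 hprim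
  have huS : Integrable fun x => u x * S x := by
    refine (integrableOn_iff_integrable_of_support_subset (s := Ioo 0 1) fun x hx => ?_).1
      (hui.mul_bdd (c := 1) hSm.aestronglyMeasurable (ae_of_all _ hS1))
    by_contra hc
    exact hx (by simp only [hz1 x hc, mul_zero])
  have huS' : Integrable fun x => u x * S (x - h) := by
    refine (integrableOn_iff_integrable_of_support_subset (s := Ioo 0 1) fun x hx => ?_).1
      (hui.mul_bdd (c := 1) (hSm.comp (measurable_id.sub_const h)).aestronglyMeasurable
        (ae_of_all _ fun x => hS1 _))
    by_contra hc
    exact hx (by simp only [hz2 x hc, mul_zero])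
  have huS'' : Integrable fun x => u (x + h) * S x := by
    simpa using huS'.comp_add_right h
  have hshift : ∫ x, u x * S (x - h) = ∫ x, u (x + h) * S x := by
    rw [← integral_add_right_eq_self (fun x => u x * S (x - h)) h]
    simp
  have hR : ∫ x, u x * w x ∂μ01 = ∫ x, u x * w x :=
    setIntegral_eq_integral_of_forall_compl_eq_zero
      (fun y hy => by simp only [hw]; rw [hz1 y hy, hz2 y hy, sub_zero, mul_zero])
  refine le_trans (le_of_eq ?_) key
  rw [hR]
  simp only [hw, mul_sub]
  rw [integral_sub huS' huS, hshift, ← integral_sub huS'' huS, ← integral_indicator measurableSet_Ioo]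
  congr 1
  ext x
  by_cases hx : x ∈ Ioo 0 (1 - h)
  · simp only [hS, indicator_of_mem hx]
    rw [← sub_mul]
    rcases lt_trichotomy (u (x + h) - u x) 0 with hs | hs | hs
    · rw [Real.sign_of_neg hs, abs_of_neg hs, mul_neg_one]
    · rw [hs]; simp
    · rw [Real.sign_of_pos hs, abs_of_pos hs, mul_one]
  · simp only [hS, indicator_of_notMem hx]
    ring

theorem integrableOn_shift_sub {a : ℝ → ℝ} (ha : Integrable a μ01) {h : ℝ} (h0 : 0 < h) :
    IntegrableOn (fun x => a (x + h) - a x) (Ioo 0 (1 - h)) := by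
  have ha' : IntegrableOn a (Ioo 0 1) := ha
  refine IntegrableOn.sub ?_ (ha'.mono_set (Ioo_subset_Ioo_right (by linarith)))
  have : Integrable ((Ioo (0 : ℝ) 1).indicator a) := ha'.integrable_indicator measurableSet_Ioo
  refine ((this.comp_add_right h).integrableOn (s := Ioo 0 (1 - h))).congr_fun (fun x hx => ?_)
    measurableSet_Ioo
  exact indicator_of_mem (show x + h ∈ Ioo (0 : ℝ) 1 from
    ⟨by linarith [hx.1], by linarith [hx.2]⟩) _

/-- Discrete integration by parts: the shift moves from `φ` to `a`. There are no boundary terms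
because `φ` vanishes off `(0, 1 - h)`. -/
theorem abs_integral_mul_sub_shift_le {a φ : ℝ → ℝ} (ha : Integrable a μ01) (hφ : Continuous φ)
    (hφ1 : ∀ x, |φ x| ≤ 1) {h : ℝ} (h0 : 0 < h)
    (hsupp : ∀ x, x ∉ Ioo 0 (1 - h) → φ x = 0) :
    |∫ x, a x * (φ x - φ (x - h)) ∂μ01| ≤ ∫ x in Ioo 0 (1 - h), |a (x + h) - a x| := by
  have ha' : IntegrableOn a (Ioo 0 1) := ha
  have hz1 : ∀ y, y ∉ Ioo (0 : ℝ) 1 → φ y = 0 := fun y hy => hsupp y fun hc =>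
    hy ⟨hc.1, by linarith [hc.2]⟩
  have hz2 : ∀ y, y ∉ Ioo (0 : ℝ) 1 → φ (y - h) = 0 := fun y hy => hsupp _ fun hc =>
    hy ⟨by linarith [hc.1], by linarith [hc.2]⟩
  have i1 : Integrable fun x => a x * φ x := by
    refine (integrableOn_iff_integrable_of_support_subset (s := Ioo 0 1) fun x hx => ?_).1
      (ha'.mul_bdd (c := 1) hφ.aestronglyMeasurable (ae_of_all _ hφ1))
    by_contra hc
    exact hx (by simp only [hz1 x hc, mul_zero])
  have i2 : Integrable fun x => a x * φ (x - h) := by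
    refine (integrableOn_iff_integrable_of_support_subset (s := Ioo 0 1) fun x hx => ?_).1
      (ha'.mul_bdd (c := 1) (hφ.comp (continuous_id.sub continuous_const)).aestronglyMeasurable
        (ae_of_all _ fun x => hφ1 _))
    by_contra hc
    exact hx (by simp only [hz2 x hc, mul_zero])
  have i3 : Integrable fun x => a (x + h) * φ x := by simpa using i2.comp_add_right h
  have hshift : ∫ x, a x * φ (x - h) = ∫ x, a (x + h) * φ x := by
    rw [← integral_add_right_eq_self (fun x => a x * φ (x - h)) h]
    simp
  have e : ∫ x, a x * (φ x - φ (x - h)) ∂μ01 =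
      ∫ x in Ioo 0 (1 - h), (a x - a (x + h)) * φ x := by
    rw [setIntegral_eq_integral_of_forall_compl_eq_zero
        (fun y hy => by rw [hz1 y hy, hz2 y hy, sub_zero, mul_zero]),
      setIntegral_eq_integral_of_forall_compl_eq_zero
        (fun y hy => by rw [hsupp y hy, mul_zero])]
    simp only [mul_sub, sub_mul]
    rw [integral_sub i1 i2, hshift, ← integral_sub i1 i3]
  have hai := integrableOn_shift_sub ha h0
  rw [e]
  refine abs_integral_le_integral_abs.trans (integral_mono_of_nonneg
    (ae_of_all _ fun x => abs_nonneg _) hai.abs (ae_of_all _ fun x => ?_))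
  beta_reduce
  rw [abs_mul, abs_sub_comm]
  exact mul_le_of_le_one_right (abs_nonneg _) (hφ1 x)

theorem tendsto_integral_mul_diffQuot {a φ : ℝ → ℝ} (ha : Integrable a μ01)
    (h1 : ContDiff ℝ 1 φ) (h2 : HasCompactSupport φ) :
    Tendsto (fun h : ℝ => h⁻¹ * ∫ x, a x * (φ x - φ (x - h)) ∂μ01) (𝓝[>] 0)
      (𝓝 (∫ x, a x * deriv φ x ∂μ01)) := by
  obtain ⟨M, hM⟩ := h2.deriv.exists_bound_of_continuous (h1.continuous_deriv le_rfl)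
  have hlip : ∀ x y, |φ x - φ y| ≤ M * |x - y| := fun x y =>
    Convex.norm_image_sub_le_of_norm_deriv_le (fun z _ => h1.differentiable one_ne_zero z)
      (fun z _ => hM z) convex_univ (mem_univ y) (mem_univ x)
  simp_rw [← integral_const_mul]
  refine tendsto_integral_filter_of_dominated_convergence (fun x => |a x| * M) ?_ ?_
    (ha.abs.mul_const M) (ae_of_all _ fun x => ?_)
  · refine Eventually.of_forall fun h => ?_
    have := h1.continuous
    exact (ha.aestronglyMeasurable.mul (by fun_prop : Continuous fun x =>
      φ x - φ (x - h)).aestronglyMeasurable).const_mul _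
  · filter_upwards [self_mem_nhdsWithin] with h hh
    have hh : 0 < h := hh
    refine ae_of_all _ fun x => ?_
    rw [Real.norm_eq_abs, abs_mul, abs_mul, abs_inv, abs_of_pos hh, inv_mul_le_iff₀ hh]
    have := hlip x (x - h)
    rw [sub_sub_cancel, abs_of_pos hh] at this
    nlinarith [abs_nonneg (a x)]
  · have hd : HasDerivAt φ (deriv φ x) x := (h1.differentiable one_ne_zero x).hasDerivAt
    have ht := hd.tendsto_slope_zero
    -- The quotient is a backward one, that is, the slope at increment `-h`.
    have hneg : Tendsto (fun h : ℝ => -h) (𝓝[>] 0) (𝓝[≠] 0) := by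
      refine tendsto_nhdsWithin_iff.2 ⟨?_, ?_⟩
      · exact ((continuous_neg.tendsto' (0 : ℝ) 0 neg_zero).mono_left nhdsWithin_le_nhds)
      · filter_upwards [self_mem_nhdsWithin] with h hh
        exact neg_ne_zero.2 (ne_of_gt hh)
    refine ((ht.comp hneg).const_mul (a x)).congr fun h => ?_
    simp only [Function.comp, smul_eq_mul, inv_neg, ← sub_eq_add_neg]
    ring

theorem eventually_eq_zero_of_tsupport_subset {φ : ℝ → ℝ} (h2 : HasCompactSupport φ)
    (h3 : tsupport φ ⊆ Ioo (0 : ℝ) 1) :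
    ∀ᶠ h : ℝ in 𝓝[>] 0, ∀ x, x ∉ Ioo 0 (1 - h) → φ x = 0 := by
  rcases (tsupport φ).eq_empty_or_nonempty with he | hne
  · exact Eventually.of_forall fun h x _ => image_eq_zero_of_notMem_tsupport (by simp [he])
  · obtain ⟨β, hβ, hmax⟩ := IsCompact.exists_isMaxOn h2 hne continuous_id.continuousOn
    have h1 : 0 < 1 - β := by linarith [(h3 hβ).2]
    filter_upwards [Ioo_mem_nhdsGT h1] with h hh x hx
    refine image_eq_zero_of_notMem_tsupport fun hc => hx ⟨(h3 hc).1, ?_⟩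
    have : x ≤ β := hmax hc
    linarith [hh.2]

/-- Derivatives of the test functions are replaced by difference quotients, where the pointwise
bound on increments can be integrated and compared with the translation estimate for `u`. Treating
`a` and `b` jointly keeps the sharp constant `C` for the sum. -/
theorem abs_add_abs_integral_mul_deriv_le {u a b : ℝ → ℝ} {C : ℝ} (hC : 0 ≤ C)
    (hum : Measurable u)
    (huL : MemLp u 2 μ01) (hu : totalVar u ≠ ∞) (ha : Integrable a μ01) (hb : Integrable b μ01)
    (hab : ∀ x y, |a x - a y| + |b x - b y| ≤ C * |u x - u y|) {φ ψ : ℝ → ℝ}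
    (hφ : ContDiff ℝ 1 φ ∧ HasCompactSupport φ ∧ tsupport φ ⊆ Ioo (0 : ℝ) 1 ∧ ∀ x, |φ x| ≤ 1)
    (hψ : ContDiff ℝ 1 ψ ∧ HasCompactSupport ψ ∧ tsupport ψ ⊆ Ioo (0 : ℝ) 1 ∧ ∀ x, |ψ x| ≤ 1) :
    |∫ x, a x * deriv φ x ∂μ01| + |∫ x, b x * deriv ψ x ∂μ01| ≤ C * (totalVar u).toReal := by
  obtain ⟨p1, p2, p3, p4⟩ := hφ
  obtain ⟨q1, q2, q3, q4⟩ := hψ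
  refine le_of_tendsto ((tendsto_integral_mul_diffQuot ha p1 p2).abs.add
    (tendsto_integral_mul_diffQuot hb q1 q2).abs) ?_
  filter_upwards [self_mem_nhdsWithin, eventually_eq_zero_of_tsupport_subset p2 p3,
    eventually_eq_zero_of_tsupport_subset q2 q3] with h hh hp hq
  have h0 : 0 < h := hh
  have ea := abs_integral_mul_sub_shift_le ha p1.continuous p4 h0 hp
  have eb := abs_integral_mul_sub_shift_le hb q1.continuous q4 h0 hq
  have ia := (integrableOn_shift_sub ha h0).abs
  have ib := (integrableOn_shift_sub hb h0).abs
  have iu := (integrableOn_shift_sub (huL.integrable (by norm_num)) h0).abs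
  have hsum : (∫ x in Ioo 0 (1 - h), |a (x + h) - a x|) + ∫ x in Ioo 0 (1 - h), |b (x + h) - b x|
      ≤ C * ∫ x in Ioo 0 (1 - h), |u (x + h) - u x| := by
    rw [← integral_add ia ib, ← integral_const_mul]
    exact integral_mono (ia.add ib) (iu.const_mul C) fun x => hab _ _
  have hu' := mul_le_mul_of_nonneg_left (setIntegral_abs_sub_shift_le hum huL hu h0) hC
  rw [abs_mul, abs_mul, abs_inv, abs_of_pos h0, ← mul_add, inv_mul_le_iff₀ h0]
  linarith

theorem totalVar_add_totalVar_le {u a b : ℝ → ℝ} {C : ℝ} (hC : 0 ≤ C) (hum : Measurable u)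
    (huL : MemLp u 2 μ01) (hu : totalVar u ≠ ∞) (ha : Integrable a μ01) (hb : Integrable b μ01)
    (hab : ∀ x y, |a x - a y| + |b x - b y| ≤ C * |u x - u y|) :
    totalVar a + totalVar b ≤ ENNReal.ofReal (C * (totalVar u).toReal) := by
  -- The zero test function shows that the suprema range over a nonempty class.
  have hz : ContDiff ℝ 1 (fun _ : ℝ => (0 : ℝ)) ∧ HasCompactSupport (fun _ : ℝ => (0 : ℝ)) ∧
      tsupport (fun _ : ℝ => (0 : ℝ)) ⊆ Ioo (0 : ℝ) 1 ∧ ∀ x : ℝ, |(fun _ : ℝ => (0 : ℝ)) x| ≤ 1 :=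
    ⟨contDiff_const, HasCompactSupport.zero, by
      rw [show (fun _ : ℝ => (0 : ℝ)) = 0 from rfl, tsupport_zero]; exact empty_subset _, by simp⟩
  unfold totalVar
  refine ENNReal.biSup_add_biSup_le' ⟨fun _ => 0, hz⟩ ⟨fun _ => 0, hz⟩ fun φ hφ ψ hψ => ?_
  refine (add_le_add (ENNReal.ofReal_le_ofReal (le_abs_self _))
    (ENNReal.ofReal_le_ofReal (le_abs_self _))).trans ?_
  rw [← ENNReal.ofReal_add (abs_nonneg _) (abs_nonneg _)]
  exact ENNReal.ofReal_le_ofReal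
    (abs_add_abs_integral_mul_deriv_le hC hum huL hu ha hb hab hφ hψ)

/-! ### Weighted errors and their best constants -/

/-- The squared error of `v` as an approximation of `f`, weighted by `w`. -/
def weightedError (f w v : ℝ → ℝ) : ℝ := ∫ x, w x * (v x - f x) ^ 2 ∂μ01

/-- A measurable function with values in `[0,1]` almost everywhere. -/
def IsUnitWeight (w : ℝ → ℝ) : Prop :=
  AEStronglyMeasurable w μ01 ∧ ∀ᵐ x ∂μ01, w x ∈ Icc (0 : ℝ) 1

namespace IsUnitWeight

variable {f w v : ℝ → ℝ}

theorem one_sub (hw : IsUnitWeight w) : IsUnitWeight fun x => 1 - w x :=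
  ⟨aestronglyMeasurable_const.sub hw.1,
    hw.2.mono fun x hx => ⟨by linarith [hx.2], by linarith [hx.1]⟩⟩

theorem ae_norm_le (hw : IsUnitWeight w) : ∀ᵐ x ∂μ01, ‖w x‖ ≤ 1 :=
  hw.2.mono fun x hx => by rw [Real.norm_eq_abs, abs_of_nonneg hx.1]; exact hx.2

theorem memLp (hw : IsUnitWeight w) : MemLp w 2 μ01 := MemLp.of_bound hw.1 1 hw.ae_norm_le

theorem integrable (hw : IsUnitWeight w) : Integrable w μ01 := hw.memLp.integrable (by norm_num)

theorem mul_integrable (hw : IsUnitWeight w) (hv : Integrable v μ01) :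
    Integrable (fun x => w x * v x) μ01 :=
  hv.bdd_mul hw.1 hw.ae_norm_le

theorem integrable_error (hw : IsUnitWeight w) (hf : IsUnitWeight f) (hv : MemLp v 2 μ01) :
    Integrable (fun x => w x * (v x - f x) ^ 2) μ01 :=
  hw.mul_integrable (hv.sub hf.memLp).integrable_sq

theorem weightedError_nonneg (hw : IsUnitWeight w) : 0 ≤ weightedError f w v :=
  integral_nonneg_of_ae (hw.2.mono fun _ hx => mul_nonneg hx.1 (sq_nonneg _))

theorem integral_nonneg (hw : IsUnitWeight w) : 0 ≤ ∫ x, w x ∂μ01 :=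
  integral_nonneg_of_ae (hw.2.mono fun _ hx => hx.1)

theorem integral_le_one (hw : IsUnitWeight w) : ∫ x, w x ∂μ01 ≤ 1 := by
  have := integral_mono_ae hw.integrable (integrable_const (1 : ℝ)) (hw.2.mono fun _ hx => hx.2)
  simpa using this

/-- Replacing `v` by a suitable constant raises the weighted error by at most twice the total
variation of `v`. -/
theorem exists_const_weightedError_le (hw : IsUnitWeight w) (hf : IsUnitWeight f)
    (hvL : MemLp v 2 μ01) (hv : totalVar v ≠ ∞) :
    ∃ c : ℝ, weightedError f w (fun _ => c) ≤ weightedError f w v + 2 * (totalVar v).toReal := by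
  set A := ∫ x, w x ∂μ01 with hA
  rcases hw.integral_nonneg.eq_or_lt with h0 | hpos
  · have hz := (integral_eq_zero_iff_of_nonneg_ae (hw.2.mono fun _ hx => hx.1) hw.integrable).1
      h0.symm
    have : ∀ v, weightedError f w v = 0 := fun v =>
      integral_eq_zero_of_ae (hz.mono fun x hx => by simp [show w x = 0 from hx])
    exact ⟨0, by rw [this, this]; positivity⟩
  have hwf := hw.mul_integrable hf.integrable
  -- The weighted mean of `f` is the constant for which `W` below integrates to zero.
  set c := (∫ x, w x * f x ∂μ01) / A with hc
  have hcA : c * A = ∫ x, w x * f x ∂μ01 := div_mul_cancel₀ _ hpos.ne'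
  have hc0 : 0 ≤ c := by
    refine div_nonneg (integral_nonneg_of_ae ?_) hpos.le
    filter_upwards [hw.2, hf.2] with x h1 h2 using mul_nonneg h1.1 h2.1
  have hc1 : c ≤ 1 := by
    refine (div_le_one hpos).2 (integral_mono_ae hwf hw.integrable ?_)
    filter_upwards [hw.2, hf.2] with x h1 h2 using mul_le_of_le_one_right h1.1 h2.2
  set W : ℝ → ℝ := fun x => w x * (f x - c) with hW
  have hWb : ∀ᵐ x ∂μ01, ‖W x‖ ≤ 1 := by
    filter_upwards [hw.2, hf.2] with x h1 h2
    rw [Real.norm_eq_abs, abs_le]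
    simp only [hW]
    constructor <;> nlinarith [h1.1, h1.2, h2.1, h2.2]
  have hWm : AEStronglyMeasurable W μ01 := hw.1.mul (hf.1.sub aestronglyMeasurable_const)
  have hWL : MemLp W 2 μ01 := MemLp.of_bound hWm 1 hWb
  have hWi := hWL.integrable (by norm_num)
  have hW0 : ∫ x, W x ∂μ01 = 0 := by
    have : ∀ x, W x = w x * f x - c * w x := fun x => by simp only [hW]; ring
    simp_rw [this]
    rw [integral_sub hwf (hw.integrable.const_mul c), integral_const_mul, ← hA, hcA, sub_self]
  -- This bounds the primitive of `W` by 1 and so gives the constant 2 in the conclusion.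
  have hW1 : ∫ x, |W x| ∂μ01 ≤ 1 := by
    have := integral_mono_ae hWi.norm (integrable_const (1 : ℝ)) hWb
    simpa using this
  have key := integral_mul_le_mul_totalVar hvL hv hWL hW0
    fun x hx => (abs_primitive_le hWi hx).trans hW1
  have hcL : MemLp (fun _ : ℝ => c) 2 μ01 := memLp_const c
  have hvW : Integrable (fun x => v x * W x) μ01 := hvL.integrable_mul hWL
  have i1 := hw.integrable_error hf hvL
  have i2 := hw.integrable_error hf hcL
  -- Tangent line inequality for the square at `c`; the discarded term is `w (v - c)²`.
  have hmono : ∫ x, (w x * (c - f x) ^ 2 - 2 * (v x * W x) + 2 * c * W x) ∂μ01 ≤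
      weightedError f w v := by
    refine integral_mono_ae ((i2.sub (hvW.const_mul 2)).add (hWi.const_mul _)) i1 ?_
    filter_upwards [hw.2] with x h1
    simp only [hW]
    nlinarith [mul_nonneg h1.1 (sq_nonneg (v x - c))]
  have i3 : Integrable (fun x => w x * (c - f x) ^ 2 - 2 * (v x * W x)) μ01 :=
    i2.sub (hvW.const_mul 2)
  rw [integral_add i3 (hWi.const_mul _), integral_sub i2 (hvW.const_mul 2), integral_const_mul,
    integral_const_mul, hW0] at hmono
  refine ⟨c, ?_⟩
  have : weightedError f w (fun _ => c) = ∫ x, w x * (c - f x) ^ 2 ∂μ01 := rfl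
  linarith

/-- A constant of least weighted error is a weighted mean. -/
theorem integral_mul_sub_eq_zero (hw : IsUnitWeight w) (hf : IsUnitWeight f) {c : ℝ}
    (hc : ∀ k : ℝ, weightedError f w (fun _ => c) ≤ weightedError f w fun _ => k) :
    ∫ x, w x * (f x - c) ∂μ01 = 0 := by
  set B := ∫ x, w x * (f x - c) ∂μ01 with hB
  have i1 := hw.integrable_error (v := fun _ => c) hf (memLp_const c)
  have i2 : Integrable (fun x => w x * (f x - c)) μ01 :=
    hw.mul_integrable (hf.integrable.sub (integrable_const c))
  have e : weightedError f w (fun _ => c + B) =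
      weightedError f w (fun _ => c) - 2 * B * B + B ^ 2 * ∫ x, w x ∂μ01 := by
    have : ∀ x, w x * (c + B - f x) ^ 2 =
        w x * (c - f x) ^ 2 - 2 * B * (w x * (f x - c)) + B ^ 2 * w x := fun x => by ring
    have i3 : Integrable (fun x => w x * (c - f x) ^ 2 - 2 * B * (w x * (f x - c))) μ01 :=
      i1.sub (i2.const_mul _)
    unfold weightedError
    simp_rw [this]
    rw [integral_add i3 (hw.integrable.const_mul _), integral_sub i1 (i2.const_mul _),
      integral_const_mul, integral_const_mul]
  have h := hc (c + B)
  rw [e] at h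
  have := mul_le_mul_of_nonneg_left hw.integral_le_one (sq_nonneg B)
  nlinarith

theorem lintegral_fidelity (hw : IsUnitWeight w) (hf : IsUnitWeight f) {v₁ v₂ : ℝ → ℝ}
    (h1 : MemLp v₁ 2 μ01) (h2 : MemLp v₂ 2 μ01) :
    ∫⁻ x, ENNReal.ofReal (w x * (v₁ x - f x) ^ 2 + (1 - w x) * (v₂ x - f x) ^ 2) ∂μ01 =
      ENNReal.ofReal (weightedError f w v₁ + weightedError f (fun x => 1 - w x) v₂) := by
  have i1 := hw.integrable_error hf h1
  have i2 := hw.one_sub.integrable_error hf h2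
  have i3 : Integrable (fun x => w x * (v₁ x - f x) ^ 2 + (1 - w x) * (v₂ x - f x) ^ 2) μ01 :=
    i1.add i2
  unfold weightedError
  rw [← integral_add i1 i2, ofReal_integral_eq_lintegral_ofReal i3]
  filter_upwards [hw.2] with x hx
  exact add_nonneg (mul_nonneg hx.1 (sq_nonneg _)) (mul_nonneg (sub_nonneg.2 hx.2) (sq_nonneg _))

end IsUnitWeight

/-! ### The energy, constancy of `v₁`, `v₂`, and independence of `ε` -/

theorem lintegral_convexInd_eq_zero {w : ℝ → ℝ} (hw : ∀ᵐ x ∂μ01, w x ∈ Icc (0 : ℝ) 1) :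
    ∫⁻ x, convexInd (w x) ∂μ01 = 0 := by
  rw [lintegral_congr_ae (g := fun _ => 0) (hw.mono fun x hx => by simp only [convexInd, if_pos hx])]
  simp

theorem isUnitWeight_of_energy_ne_top {lam ε : ℝ} {f : ℝ → ℝ} {w v₁ v₂ : L2}
    (h : energy lam f ε w v₁ v₂ ≠ ∞) : IsUnitWeight w := by
  refine ⟨(Lp.memLp w).1, ?_⟩
  have hfin : ∫⁻ x, convexInd (w x) ∂μ01 ≠ ∞ :=
    ne_top_of_le_ne_top h (by unfold energy; exact le_add_self)
  have hm : Measurable convexInd :=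
    Measurable.ite measurableSet_Icc measurable_const measurable_const
  have hw : AEMeasurable (fun x => convexInd (w x)) μ01 :=
    hm.comp_aemeasurable (Lp.memLp w).1.aemeasurable
  filter_upwards [ae_lt_top' hw hfin] with x hx
  by_contra hc
  rw [convexInd, if_neg hc] at hx
  exact hx.ne rfl

theorem energy_eq {lam ε : ℝ} {f : ℝ → ℝ} (hf : IsUnitWeight f) {w v₁ v₂ : L2}
    (hw : IsUnitWeight w) :
    energy lam f ε w v₁ v₂ = totalVar w + ENNReal.ofReal (1 / ε) * (totalVar v₁ + totalVar v₂) +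
      ENNReal.ofReal lam * ENNReal.ofReal
        (weightedError f w v₁ + weightedError f (fun x => 1 - w x) v₂) := by
  unfold energy
  rw [lintegral_convexInd_eq_zero hw.2, hw.lintegral_fidelity hf (Lp.memLp _) (Lp.memLp _),
    add_zero]

theorem weightedError_congr {f w w' v v' : ℝ → ℝ} (hw : w =ᵐ[μ01] w') (hv : v =ᵐ[μ01] v') :
    weightedError f w v = weightedError f w' v' :=
  integral_congr_ae (by filter_upwards [hw, hv] with x h1 h2; rw [h1, h2])

/-- The constant function `c` as an element of `L²(0,1)`. -/
def constL2 (c : ℝ) : L2 := (memLp_const c : MemLp (fun _ : ℝ => c) 2 μ01).toLp _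

theorem coe_constL2 (c : ℝ) : (constL2 c : ℝ → ℝ) =ᵐ[μ01] fun _ => c := MemLp.coeFn_toLp _

theorem totalVar_constL2 (c : ℝ) : totalVar (constL2 c) = 0 := by
  rw [totalVar_congr (coe_constL2 c), totalVar_const]

theorem energy_const_eq {lam ε : ℝ} (hlam : 0 ≤ lam) {f : ℝ → ℝ} (hf : IsUnitWeight f) {w : L2}
    {v₁ v₂ : L2} {c₁ c₂ : ℝ} (h₁ : v₁ =ᵐ[μ01] fun _ => c₁) (h₂ : v₂ =ᵐ[μ01] fun _ => c₂)
    (hw : IsUnitWeight w) :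
    energy lam f ε w v₁ v₂ = totalVar w + ENNReal.ofReal (lam *
        (weightedError f w (fun _ => c₁) + weightedError f (fun x => 1 - w x) fun _ => c₂)) := by
  rw [energy_eq hf hw, totalVar_congr h₁, totalVar_congr h₂, totalVar_const, totalVar_const,
    ENNReal.ofReal_mul hlam, weightedError_congr (EventuallyEq.refl _ _) h₁,
    weightedError_congr (EventuallyEq.refl _ _) h₂]
  simp

/-- Constants `c₁, c₂` improve on `v₁, v₂` by a definite multiple of their total variation. -/
theorem exists_energy_const_add_le {lam ε : ℝ} (hlam : 0 ≤ lam) (hε : 0 < ε)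
    (hεlam : 4 * lam * ε < 1) {f : ℝ → ℝ} (hf : IsUnitWeight f) (w v₁ v₂ : L2) :
    ∃ c₁ c₂ : ℝ, energy lam f ε w (constL2 c₁) (constL2 c₂) +
      ENNReal.ofReal (1 / ε - 2 * lam) * (totalVar v₁ + totalVar v₂) ≤ energy lam f ε w v₁ v₂ := by
  by_cases htop : energy lam f ε w v₁ v₂ = ∞
  · exact ⟨0, 0, by rw [htop]; exact le_top⟩
  have hw := isUnitWeight_of_energy_ne_top htop
  have hεpos : ENNReal.ofReal (1 / ε) ≠ 0 := by
    simpa using hε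
  have hgap : 0 ≤ 1 / ε - 2 * lam := by
    rw [sub_nonneg, le_div_iff₀ hε]; nlinarith [mul_nonneg hlam hε.le]
  rw [energy_eq hf hw] at htop ⊢
  have hT : totalVar v₁ + totalVar v₂ ≠ ∞ := fun h => htop (by
    rw [h, ENNReal.mul_top hεpos, add_top, top_add])
  obtain ⟨hT1, hT2⟩ := ENNReal.add_ne_top.1 hT
  obtain ⟨c₁, h₁⟩ := hw.exists_const_weightedError_le hf (Lp.memLp v₁) hT1
  obtain ⟨c₂, h₂⟩ := hw.one_sub.exists_const_weightedError_le hf (Lp.memLp v₂) hT2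
  refine ⟨c₁, c₂, ?_⟩
  rw [energy_const_eq hlam hf (coe_constL2 c₁) (coe_constL2 c₂) hw]
  set T₁ := (totalVar v₁).toReal
  set T₂ := (totalVar v₂).toReal
  have hT1' : 0 ≤ T₁ := ENNReal.toReal_nonneg
  have hT2' : 0 ≤ T₂ := ENNReal.toReal_nonneg
  have hTs : totalVar v₁ + totalVar v₂ = ENNReal.ofReal (T₁ + T₂) := by
    rw [ENNReal.ofReal_add hT1' hT2', ENNReal.ofReal_toReal hT1, ENNReal.ofReal_toReal hT2]
  have n1 := hw.weightedError_nonneg (f := f) (v := v₁)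
  have n2 := hw.one_sub.weightedError_nonneg (f := f) (v := v₂)
  have n3 := hw.weightedError_nonneg (f := f) (v := fun _ => c₁)
  have n4 := hw.one_sub.weightedError_nonneg (f := f) (v := fun _ => c₂)
  rw [hTs, ← ENNReal.ofReal_mul hgap, ← ENNReal.ofReal_mul (by positivity),
    ← ENNReal.ofReal_mul hlam, add_assoc, add_assoc, ← ENNReal.ofReal_add (by positivity)
    (by positivity), ← ENNReal.ofReal_add (by positivity) (by positivity)]
  refine add_le_add_right (ENNReal.ofReal_le_ofReal ?_) _
  have := mul_le_mul_of_nonneg_left (add_le_add h₁ h₂) hlam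
  nlinarith

theorem IsMinimizer.energy_ne_top {lam ε : ℝ} {f : ℝ → ℝ} (hf : IsUnitWeight f) {u v₁ v₂ : L2}
    (hlam : 0 ≤ lam) (h : IsMinimizer lam f ε u v₁ v₂) : energy lam f ε u v₁ v₂ ≠ ∞ := by
  have hz : IsUnitWeight (constL2 0) :=
    ⟨(Lp.memLp _).1, (coe_constL2 0).mono fun x hx => by rw [hx]; simp⟩
  refine ne_top_of_le_ne_top ?_ (h (constL2 0) (constL2 0) (constL2 0))
  rw [energy_const_eq hlam hf (coe_constL2 0) (coe_constL2 0) hz, totalVar_constL2, zero_add]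
  exact ENNReal.ofReal_ne_top

/-- A minimizer cannot gain by passing to constants, yet would gain a strictly positive multiple of
the variation. -/
theorem IsMinimizer.totalVar_eq_zero {lam ε : ℝ} {f : ℝ → ℝ} (hf : IsUnitWeight f)
    {u v₁ v₂ : L2} (hlam : 0 ≤ lam) (hε : 0 < ε) (hεlam : 4 * lam * ε < 1)
    (h : IsMinimizer lam f ε u v₁ v₂) : totalVar v₁ = 0 ∧ totalVar v₂ = 0 := by
  obtain ⟨c₁, c₂, hc⟩ := exists_energy_const_add_le hlam hε hεlam hf u v₁ v₂
  have h1 := hc.trans (h u (constL2 c₁) (constL2 c₂))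
  have hfin : energy lam f ε u (constL2 c₁) (constL2 c₂) ≠ ∞ :=
    ne_top_of_le_ne_top (h.energy_ne_top hf hlam) (le_self_add.trans hc)
  have h2 : ENNReal.ofReal (1 / ε - 2 * lam) * (totalVar v₁ + totalVar v₂) = 0 := by
    have : energy lam f ε u (constL2 c₁) (constL2 c₂) +
        ENNReal.ofReal (1 / ε - 2 * lam) * (totalVar v₁ + totalVar v₂) ≤
        energy lam f ε u (constL2 c₁) (constL2 c₂) + 0 := by rwa [add_zero]
    exact le_antisymm ((ENNReal.add_le_add_iff_left hfin).1 this) bot_le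
  have hgap : 0 < 1 / ε - 2 * lam := by
    rw [sub_pos, lt_div_iff₀ hε]; nlinarith [mul_nonneg hlam hε.le]
  rcases mul_eq_zero.1 h2 with h3 | h3
  · exact absurd h3 (by simpa using hgap)
  · exact add_eq_zero.1 h3

theorem energy_congr_eps {lam ε ε' : ℝ} {f : ℝ → ℝ} {u v₁ v₂ : L2} (h1 : totalVar v₁ = 0)
    (h2 : totalVar v₂ = 0) : energy lam f ε u v₁ v₂ = energy lam f ε' u v₁ v₂ := by
  simp [energy, h1, h2]

/-- `ε` only multiplies variations of `v₁`, `v₂`. These vanish for the minimizer, and every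
competitor is beaten by one with constants, for which they vanish too. -/
theorem IsMinimizer.congr_eps {lam ε ε' : ℝ} {f : ℝ → ℝ} (hf : IsUnitWeight f)
    {u v₁ v₂ : L2} (hlam : 0 ≤ lam) (hε : 0 < ε) (hεlam : 4 * lam * ε < 1)
    (hε' : 0 < ε') (hεlam' : 4 * lam * ε' < 1)
    (h : IsMinimizer lam f ε u v₁ v₂) : IsMinimizer lam f ε' u v₁ v₂ := by
  intro w w₁ w₂
  obtain ⟨h1, h2⟩ := h.totalVar_eq_zero hf hlam hε hεlam
  obtain ⟨c₁, c₂, hc⟩ := exists_energy_const_add_le hlam hε' hεlam' hf w w₁ w₂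
  calc energy lam f ε' u v₁ v₂ = energy lam f ε u v₁ v₂ := energy_congr_eps h1 h2
    _ ≤ energy lam f ε w (constL2 c₁) (constL2 c₂) := h _ _ _
    _ = energy lam f ε' w (constL2 c₁) (constL2 c₂) :=
        energy_congr_eps (totalVar_constL2 _) (totalVar_constL2 _)
    _ ≤ energy lam f ε' w w₁ w₂ := le_self_add.trans hc

/-! ### Two-valuedness of `u` -/

/-- A `u` with intermediate values would be the midpoint of two distinct optimal weights `a` and `b`
sharing the best constants `c₁`, `c₂`, which is impossible when `c₁ ≠ c₂`. -/
theorem two_valued_of_le {lam : ℝ} (hlam : 0 < lam) {f u : ℝ → ℝ} (hf : IsUnitWeight f)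
    (hu : IsUnitWeight u) (hum : Measurable u) (huT : totalVar u ≠ ∞) {c₁ c₂ : ℝ} (hne : c₁ ≠ c₂)
    (hmin : ∀ (w : ℝ → ℝ) (k₁ k₂ : ℝ), IsUnitWeight w → totalVar w ≠ ∞ →
      (totalVar u).toReal + lam * (weightedError f u (fun _ => c₁) +
        weightedError f (fun x => 1 - u x) fun _ => c₂) ≤
      (totalVar w).toReal + lam * (weightedError f w (fun _ => k₁) +
        weightedError f (fun x => 1 - w x) fun _ => k₂)) :
    ∀ᵐ x ∂μ01, u x = 0 ∨ u x = 1 := by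
  -- Both are nondecreasing functions of `u` with values in `[0,1]` and sum `2u`, so their
  -- increments have equal sign and add exactly.
  set a : ℝ → ℝ := fun x => min (2 * u x) 1 with ha_def
  set b : ℝ → ℝ := fun x => max (2 * u x - 1) 0 with hb_def
  have hsum : ∀ x, a x + b x = 2 * u x := by
    intro x
    simp only [ha_def, hb_def]
    rcases le_total (2 * u x) 1 with h | h
    · rw [min_eq_left h, max_eq_right (by linarith)]; ring
    · rw [min_eq_right h, max_eq_left (by linarith)]; ring
  have ha : IsUnitWeight a :=
    ⟨((hum.const_mul 2).min measurable_const).aestronglyMeasurable, hu.2.mono fun x hx =>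
      ⟨le_min (by linarith [hx.1]) zero_le_one, min_le_right _ _⟩⟩
  have hb : IsUnitWeight b :=
    ⟨(((hum.const_mul 2).sub_const 1).max measurable_const).aestronglyMeasurable,
      hu.2.mono fun x hx => ⟨le_max_right _ _, max_le (by linarith [hx.2]) zero_le_one⟩⟩
  have hmono : ∀ x y, u x ≤ u y → a x ≤ a y ∧ b x ≤ b y := fun x y h =>
    ⟨min_le_min_right _ (by linarith), max_le_max_right _ (by linarith)⟩
  have hab : ∀ x y, |a x - a y| + |b x - b y| ≤ 2 * |u x - u y| := by
    intro x y
    rcases le_total (u x) (u y) with h | h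
    · obtain ⟨h1, h2⟩ := hmono x y h
      rw [abs_of_nonpos (by linarith), abs_of_nonpos (by linarith), abs_of_nonpos (by linarith)]
      linarith [hsum x, hsum y]
    · obtain ⟨h1, h2⟩ := hmono y x h
      rw [abs_of_nonneg (by linarith), abs_of_nonneg (by linarith), abs_of_nonneg (by linarith)]
      linarith [hsum x, hsum y]
  have hTV := totalVar_add_totalVar_le zero_le_two hum hu.memLp huT ha.integrable hb.integrable hab
  have hTfin : totalVar a + totalVar b ≠ ∞ := ne_top_of_le_ne_top ENNReal.ofReal_ne_top hTV
  obtain ⟨haT, hbT⟩ := ENNReal.add_ne_top.1 hTfin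
  have hTV' : (totalVar a).toReal + (totalVar b).toReal ≤ 2 * (totalVar u).toReal := by
    rw [← ENNReal.toReal_add haT hbT]
    exact ENNReal.toReal_le_of_le_ofReal (by positivity) hTV
  have herr : ∀ (p q r : ℝ → ℝ) (c : ℝ), IsUnitWeight p → IsUnitWeight q →
      (∀ x, p x + q x = 2 * r x) → weightedError f p (fun _ => c) + weightedError f q (fun _ => c) =
        2 * weightedError f r (fun _ => c) := by
    intro p q r c hp hq h
    have hc : MemLp (fun _ : ℝ => c) 2 μ01 := memLp_const c
    unfold weightedError
    rw [← integral_add (hp.integrable_error hf hc) (hq.integrable_error hf hc),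
      ← integral_const_mul]
    congr 1
    ext x
    rw [← add_mul, h x, mul_assoc]
  have e1 := herr a b u c₁ ha hb hsum
  have e2 := herr (fun x => 1 - a x) (fun x => 1 - b x) (fun x => 1 - u x) c₂ ha.one_sub
    hb.one_sub fun x => by linarith [hsum x]
  -- A weight doing no worse than `u` with `c₁`, `c₂` is optimal too, so each constant is a best
  -- constant for it.
  have hstat : ∀ w, IsUnitWeight w → totalVar w ≠ ∞ →
      (totalVar w).toReal + lam * (weightedError f w (fun _ => c₁) +
        weightedError f (fun x => 1 - w x) fun _ => c₂) ≤
      (totalVar u).toReal + lam * (weightedError f u (fun _ => c₁) +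
        weightedError f (fun x => 1 - u x) fun _ => c₂) →
      ∫ x, w x * (f x - c₁) ∂μ01 = 0 ∧ ∫ x, (1 - w x) * (f x - c₂) ∂μ01 = 0 := by
    intro w hw hwT hle
    refine ⟨hw.integral_mul_sub_eq_zero hf fun k => ?_,
      hw.one_sub.integral_mul_sub_eq_zero hf fun k => ?_⟩
    · have h := hle.trans (hmin w k c₂ hw hwT)
      have := le_of_mul_le_mul_left (le_of_add_le_add_left h) hlam
      linarith
    · have h := hle.trans (hmin w c₁ k hw hwT)
      have := le_of_mul_le_mul_left (le_of_add_le_add_left h) hlam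
      linarith
  -- Neither `a` nor `b` beats `u`, and together they cost at most twice as much as `u`; hence each
  -- costs the same as `u`.
  have ma := hmin a c₁ c₂ ha haT
  have mb := hmin b c₁ c₂ hb hbT
  obtain ⟨a1, a2⟩ := hstat a ha haT (by nlinarith)
  obtain ⟨b1, b2⟩ := hstat b hb hbT (by nlinarith)
  have hwf : ∀ w c, IsUnitWeight w → Integrable (fun x => w x * (f x - c)) μ01 := fun w c hw =>
    hw.mul_integrable (hf.integrable.sub (integrable_const c))
  have hd1 : ∫ x, (a x * (f x - c₁) - b x * (f x - c₁)) ∂μ01 = 0 := by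
    rw [integral_sub (hwf a _ ha) (hwf b _ hb), a1, b1, sub_zero]
  have hd2 : ∫ x, ((1 - b x) * (f x - c₂) - (1 - a x) * (f x - c₂)) ∂μ01 = 0 := by
    rw [integral_sub (hwf _ _ hb.one_sub) (hwf _ _ ha.one_sub), a2, b2, sub_zero]
  have habi : Integrable (fun x => a x - b x) μ01 := ha.integrable.sub hb.integrable
  -- `f` cancels in the difference of the two orthogonality relations for `a - b`.
  have hd3 : (c₂ - c₁) * ∫ x, (a x - b x) ∂μ01 = 0 := by
    have i1 : Integrable (fun x => a x * (f x - c₁) - b x * (f x - c₁)) μ01 :=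
      (hwf a _ ha).sub (hwf b _ hb)
    have i2 : Integrable (fun x => (1 - b x) * (f x - c₂) - (1 - a x) * (f x - c₂)) μ01 :=
      (hwf _ _ hb.one_sub).sub (hwf _ _ ha.one_sub)
    have e := integral_sub i1 i2
    rw [hd1, hd2, sub_zero] at e
    rw [← integral_const_mul, ← e]
    congr 1; ext x; ring
  have hd4 : ∫ x, (a x - b x) ∂μ01 = 0 :=
    (mul_eq_zero.1 hd3).resolve_left (sub_ne_zero.2 hne.symm)
  have hnn : ∀ᵐ x ∂μ01, 0 ≤ a x - b x := by
    filter_upwards [hu.2] with x hx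
    rw [sub_nonneg]
    exact max_le (le_min (by linarith) (by linarith [hx.2]))
      (le_min (by linarith [hx.1]) zero_le_one)
  filter_upwards [(integral_eq_zero_iff_of_nonneg_ae hnn habi).1 hd4] with x hx
  have hx : a x - b x = 0 := hx
  simp only [ha_def, hb_def] at hx
  rcases le_total (2 * u x) 1 with h | h
  · rw [min_eq_left h, max_eq_right (by linarith)] at hx
    left; linarith
  · rw [min_eq_right h, max_eq_left (by linarith)] at hx
    right; linarith

end Segmentation

end

/-! ### Conclusion -/

theorem theorem2 (lam : ℝ) (hlam : 0 ≤ lam)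
    (f : ℝ → ℝ) (hfBV : Segmentation.MemBV f)
    (hf01 : ∀ᵐ x ∂Segmentation.μ01, f x ∈ Set.Icc (0 : ℝ) 1)
    (hH : Segmentation.HypothesisH f)
    (ε : ℝ) (hε : 0 < ε) (hεlam : 4 * lam * ε < 1)
    (u v₁ v₂ : Segmentation.L2) (hmin : Segmentation.IsMinimizer lam f ε u v₁ v₂) :
    (∀ ε' : ℝ, 0 < ε' → 4 * lam * ε' < 1 → Segmentation.IsMinimizer lam f ε' u v₁ v₂) ∧
    Segmentation.MemBV u ∧
    ((∃ c : ℝ, ∀ᵐ x ∂Segmentation.μ01, u x = c) ∨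
      ∀ᵐ x ∂Segmentation.μ01, u x = 0 ∨ u x = 1) := by
  open Segmentation in
  have hf : IsUnitWeight f := ⟨hfBV.1.1, hf01⟩
  have hfin := hmin.energy_ne_top hf hlam
  have hu := isUnitWeight_of_energy_ne_top hfin
  have huT : totalVar u ≠ ∞ := by
    rw [energy_eq hf hu] at hfin
    exact (ENNReal.add_ne_top.1 (ENNReal.add_ne_top.1 hfin).1).1
  refine ⟨fun ε' h0 h1 => hmin.congr_eps hf hlam hε hεlam h0 h1, ⟨hu.integrable, huT.lt_top⟩, ?_⟩
  obtain ⟨t1, t2⟩ := hmin.totalVar_eq_zero hf hlam hε hεlam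
  obtain ⟨c₁, h₁⟩ := ae_eq_const_of_totalVar_eq_zero (Lp.memLp v₁) t1
  obtain ⟨c₂, h₂⟩ := ae_eq_const_of_totalVar_eq_zero (Lp.memLp v₂) t2
  -- Minimality against constant pairs only, with finite energies rewritten as reals.
  have hreal : ∀ (w : ℝ → ℝ) (k₁ k₂ : ℝ), IsUnitWeight w → totalVar w ≠ ∞ →
      (totalVar u).toReal + lam * (weightedError f u (fun _ => c₁) +
        weightedError f (fun x => 1 - u x) fun _ => c₂) ≤
      (totalVar w).toReal + lam * (weightedError f w (fun _ => k₁) +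
        weightedError f (fun x => 1 - w x) fun _ => k₂) := by
    intro w k₁ k₂ hw hwT
    set w' : L2 := hw.memLp.toLp w
    have hww : (w' : ℝ → ℝ) =ᵐ[μ01] w := MemLp.coeFn_toLp _
    have hw' : IsUnitWeight w' := ⟨(Lp.memLp _).1, by
      filter_upwards [hww, hw.2] with x h1 h2
      rwa [h1]⟩
    have h := hmin w' (constL2 k₁) (constL2 k₂)
    rw [energy_const_eq hlam hf h₁ h₂ hu,
      energy_const_eq hlam hf (coe_constL2 k₁) (coe_constL2 k₂) hw', totalVar_congr hww,
      weightedError_congr hww (EventuallyEq.refl _ _),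
      weightedError_congr (hww.mono fun x hx => by simp only [hx] :
        (fun x => 1 - w' x) =ᵐ[μ01] fun x => 1 - w x) (EventuallyEq.refl _ _)] at h
    have h' := ENNReal.toReal_mono (ENNReal.add_ne_top.2 ⟨hwT, ENNReal.ofReal_ne_top⟩) h
    rwa [ENNReal.toReal_add huT ENNReal.ofReal_ne_top,
      ENNReal.toReal_add hwT ENNReal.ofReal_ne_top,
      ENNReal.toReal_ofReal (mul_nonneg hlam
        (add_nonneg hu.weightedError_nonneg hu.one_sub.weightedError_nonneg)),
      ENNReal.toReal_ofReal (mul_nonneg hlam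
        (add_nonneg hw.weightedError_nonneg hw.one_sub.weightedError_nonneg))] at h'
  by_cases hcase : lam = 0 ∨ c₁ = c₂
  · left
    have hzero : IsUnitWeight fun _ => (0 : ℝ) :=
      ⟨aestronglyMeasurable_const, ae_of_all _ fun _ => by simp⟩
    have h := hreal (fun _ => 0) c₁ c₂ hzero (by simp [totalVar_const])
    rw [totalVar_const] at h
    have herr : lam * (weightedError f u (fun _ => c₁) +
        weightedError f (fun x => 1 - u x) fun _ => c₂) =
        lam * (weightedError f (fun _ => 0) (fun _ => c₁) +
        weightedError f (fun x => 1 - 0) fun _ => c₂) := by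
      rcases hcase with rfl | rfl
      · simp
      · congr 1
        unfold weightedError
        rw [← integral_add (hu.integrable_error hf (memLp_const c₁))
          (hu.one_sub.integrable_error hf (memLp_const c₁)),
          ← integral_add (hzero.integrable_error hf (memLp_const c₁))
          (hzero.one_sub.integrable_error hf (memLp_const c₁))]
        congr 1; ext x; ring
    have hT0 : (totalVar u).toReal = 0 :=
      le_antisymm (by rw [ENNReal.toReal_zero] at h; linarith) ENNReal.toReal_nonneg
    exact ae_eq_const_of_totalVar_eq_zero (Lp.memLp u)
      (((ENNReal.toReal_eq_zero_iff _).1 hT0).resolve_right huT)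
  · right
    push Not at hcase
    exact two_valued_of_le (lt_of_le_of_ne hlam hcase.1.symm) hf hu
      (Lp.stronglyMeasurable u).measurable huT hcase.2 hreal
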